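/- Let $M$ be a smooth (Hausdorff, $\sigma$-compact, boundaryless) manifold of dimension $m+1$, not necessarily compact or connected, with a smooth Riemannian metric $a=\langle\cdot,\cdot\rangle$, $\alpha(y)=\sqrt{\langle y,y\rangle}$, Levi-Civita connection $\bar\nabla$, and let $\mathcal F$ be a smooth codimension-one foliation of $M$ with a smooth $a$-unit normal vector field $N$ (so $\mathcal F$ is transversally oriented). Let $\beta$ be a smooth 1-form with $\|\beta\|_\alpha<1$ at every point, where $\|\beta\|_\alpha$ is the pointwise dual norm, and let $F=\alpha+\beta$ be the corresponding Randers metric. For $y\neq0$ and tangent vectors $u,v,w$ at the same point put $$g_y(u,v)=\tfrac12\,\frac{\partial^2}{\partial s\,\partial t}F^2(y+su+tv)\Big|_{s=t=0},\qquad C_y(u,v,w)=\tfrac12\,\frac{\partial}{\partial t}\,g_{y+tw}(u,v)\Big|_{t=0}.$$ Let $n$ be the $F$-normal vector field of $\mathcal F$ with $\langle n,n\rangle=1$ on the side of $N$, that is, $g_n(n,w)=0$ for all $w\in T\mathcal F$ and $\langle n,N\rangle>0$. Let $g=g_n$ be the associated Riemannian metric, $\nabla$ its Levi-Civita connection, and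 let $C^\sharp_n$ be the $(1,1)$-tensor which is $g$-dual to the bilinear form $C_n(\cdot,\cdot,\nabla_n n)$, that is, $g(C^\sharp_n(u),v)=C_n(u,v,\nabla_n n)$. Let $\bar Z=\bar\nabla_N N$. (i) If $\bar\nabla\beta=0$, $\beta(N)$ is constant on $M$ and $\bar Z=0$ on $M$, then $C^\sharp_n=0$ on $M$. (ii) Suppose that $m>3$, that $\beta(N)$ is a nonnegative constant on $M$, that $\|\beta\|_\alpha$ is constant on $M$, and that the restriction of $\beta$ to $T\mathcal F$ does not vanish identically on $M$ (equivalently, under the previous conditions, it vanishes at no point). Then $C^\sharp_n=0$ on $M$ if and only if $\bar Z=0$ on $M$. -/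

import Mathlib

open Bundle Manifold VectorField
open scoped ContDiff

noncomputable section

namespace Randers

section Linear

/-! ### Minkowski norms on a vector space -/

variable {V : Type*} [AddCommGroup V] [Module ℝ V]

/-- The fundamental tensor of a Minkowski norm `F` on a vector space:
`g_y(u, v) = (1/2) ∂²/∂s∂t F²(y + s u + t v)` at `s = t = 0`. -/
def fundamentalTensor (F : V → ℝ) (y u v : V) : ℝ :=
  (1 / 2) * deriv (fun s : ℝ => deriv (fun t : ℝ => F (y + s • u + t • v) ^ 2) 0) 0

/-- The Cartan torsion of a Minkowski norm `F` on a vector space: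
`C_y(u, v, w) = (1/2) ∂/∂t g_{y + t w}(u, v)` at `t = 0`. -/
def cartanTorsion (F : V → ℝ) (y u v w : V) : ℝ :=
  (1 / 2) * deriv (fun t : ℝ => fundamentalTensor F (y + t • w) u v) 0

/-- The vector `w` which represents the linear form `φ` with respect to the nondegenerate bilinear
form `g`, that is, `g(w, v) = φ(v)` for all `v`. -/
def dualVector (g : V → V → ℝ) (φ : V → ℝ) : V :=
  Classical.epsilon fun w : V => ∀ v : V, g w v = φ v

end Linear

section Manifold

variable {E : Type*} [NormedAddCommGroup E] [NormedSpace ℝ E]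
  {H : Type*} [TopologicalSpace H] (I : ModelWithCorners ℝ E H)
  {M : Type*} [TopologicalSpace M] [ChartedSpace H M] [IsManifold I ∞ M]

/-! ### The Levi-Civita connection -/

/-- The right-hand side of the Koszul formula for a field `G` of bilinear forms,
`X G(Y, Z) + Y G(Z, X) - Z G(X, Y) + G([X, Y], Z) - G([Y, Z], X) + G([Z, X], Y)`. -/
def koszul (G : ∀ p : M, TangentSpace I p → TangentSpace I p → ℝ)
    (X Y Z : ∀ p : M, TangentSpace I p) (p : M) : ℝ :=
  mvfderiv I (fun q => G q (Y q) (Z q)) p (X p)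
    + mvfderiv I (fun q => G q (Z q) (X q)) p (Y p)
    - mvfderiv I (fun q => G q (X q) (Y q)) p (Z p)
    + G p (mlieBracket I X Y p) (Z p)
    - G p (mlieBracket I Y Z p) (X p)
    + G p (mlieBracket I Z X p) (Y p)

/-- `leviCivita I G X Y` is `∇_X Y`, where `∇` is the Levi-Civita connection of the metric `G`:
its value at `p` is the tangent vector `w` such that `2 G(w, Z(p))` is given by the Koszul formula
for every vector field `Z` which is differentiable at `p`. Existence and uniqueness of `w` are
proved in `existsUnique_koszul`. -/
def leviCivita (G : ∀ p : M, TangentSpace I p → TangentSpace I p → ℝ)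
    (X Y : ∀ p : M, TangentSpace I p) (p : M) : TangentSpace I p :=
  Classical.epsilon fun w : TangentSpace I p =>
    ∀ Z : ∀ q : M, TangentSpace I q, MDiffAt (T% Z) p → 2 * G p w (Z p) = koszul I G X Y Z p

theorem tensorialAt_koszul [CompleteSpace E]
    {G : ∀ p : M, TangentSpace I p → TangentSpace I p → ℝ} {p : M}
    (symm : ∀ q u v, G q u v = G q v u)
    (add : ∀ q u u' v, G q (u + u') v = G q u v + G q u' v)
    (smul : ∀ q (a : ℝ) u v, G q (a • u) v = a * G q u v)
    (diff : ∀ Y Z : ∀ q : M, TangentSpace I q, MDiffAt (T% Y) p → MDiffAt (T% Z) p →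
      MDiffAt (fun q => G q (Y q) (Z q)) p)
    {X Y : ∀ q : M, TangentSpace I q} (hX : MDiffAt (T% X) p) (hY : MDiffAt (T% Y) p) :
    TensorialAt I E (fun Z => koszul I G X Y Z p) p where
  smul := by
    intro f Z hf hZ
    have smul' : ∀ q (a : ℝ) u v, G q u (a • v) = a * G q u v := fun q a u v => by
      rw [symm, smul, symm]
    have e1 : (fun q => G q (Y q) ((f • Z) q)) = fun q => f q * G q (Y q) (Z q) := by
      ext q; exact smul' _ _ _ _
    have e2 : (fun q => G q ((f • Z) q) (X q)) = fun q => f q * G q (Z q) (X q) := by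
      ext q; exact smul _ _ _ _
    simp only [koszul, e1, e2]
    rw [mvfderiv_fun_mul hf (diff _ _ hY hZ), mvfderiv_fun_mul hf (diff _ _ hZ hX),
      mlieBracket_smul_right hf hZ, mlieBracket_smul_left hf hZ]
    simp [add, smul, smul', symm p (Y p) (Z p)]
    simp only [← neg_smul, smul]
    ring
  add := by
    intro Z Z' hZ hZ'
    have add' : ∀ q u v v', G q u (v + v') = G q u v + G q u v' := fun q u v v' => by
      rw [symm, add, symm, symm q v']
    have e1 : (fun q => G q (Y q) ((Z + Z') q))
        = fun q => G q (Y q) (Z q) + G q (Y q) (Z' q) := by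
      ext q; exact add' _ _ _ _
    have e2 : (fun q => G q ((Z + Z') q) (X q))
        = fun q => G q (Z q) (X q) + G q (Z' q) (X q) := by
      ext q; exact add _ _ _ _
    simp only [koszul, e1, e2]
    rw [mvfderiv_fun_add (diff _ _ hY hZ) (diff _ _ hY hZ'),
      mvfderiv_fun_add (diff _ _ hZ hX) (diff _ _ hZ' hX),
      mlieBracket_add_right hZ hZ', mlieBracket_add_left hZ hZ']
    simp [add, add']
    ring

/-- The Koszul formula determines `∇_X Y` for every metric. -/
theorem existsUnique_koszul [FiniteDimensional ℝ E]
    {G : ∀ p : M, TangentSpace I p → TangentSpace I p → ℝ} {p : M}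
    (symm : ∀ q u v, G q u v = G q v u)
    (add : ∀ q u u' v, G q (u + u') v = G q u v + G q u' v)
    (smul : ∀ q (a : ℝ) u v, G q (a • u) v = a * G q u v)
    (nondeg : ∀ u, (∀ v, G p u v = 0) → u = 0)
    (diff : ∀ Y Z : ∀ q : M, TangentSpace I q, MDiffAt (T% Y) p → MDiffAt (T% Z) p →
      MDiffAt (fun q => G q (Y q) (Z q)) p)
    {X Y : ∀ q : M, TangentSpace I q} (hX : MDiffAt (T% X) p) (hY : MDiffAt (T% Y) p) :
    ∃! w : TangentSpace I p, ∀ Z : ∀ q : M, TangentSpace I q, MDiffAt (T% Z) p →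
      2 * G p w (Z p) = koszul I G X Y Z p := by
  have : CompleteSpace E := FiniteDimensional.complete ℝ E
  have hT := tensorialAt_koszul I symm add smul diff hX hY
  let φ : TangentSpace I p →L[ℝ] ℝ := TensorialAt.mkHom _ p hT
  have hφ : ∀ Z : ∀ q : M, TangentSpace I q, MDiffAt (T% Z) p → φ (Z p) = koszul I G X Y Z p :=
    fun Z hZ => TensorialAt.mkHom_apply hT hZ
  have add' : ∀ q u v v', G q u (v + v') = G q u v + G q u v' := fun q u v v' => by
    rw [symm, add, symm, symm q v']
  have smul' : ∀ q (a : ℝ) u v, G q u (a • v) = a * G q u v := fun q a u v => by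
    rw [symm, smul, symm]
  let B : LinearMap.BilinForm ℝ (TangentSpace I p) :=
    LinearMap.mk₂ ℝ (G p) (add p) (smul p) (add' p) (smul' p)
  have hfin : FiniteDimensional ℝ (TangentSpace I p) := inferInstanceAs (FiniteDimensional ℝ E)
  have hinj : Function.Injective B := by
    rw [← LinearMap.ker_eq_bot, LinearMap.ker_eq_bot']
    intro u hu
    exact nondeg u fun v => congrArg (fun l => l v) hu
  have hsurj : Function.Surjective B :=
    (LinearMap.injective_iff_surjective_of_finrank_eq_finrank
      (Subspace.dual_finrank_eq (K := ℝ) (V := TangentSpace I p)).symm).1 hinj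
  obtain ⟨w, hw⟩ := hsurj ((1 / 2 : ℝ) • φ.toLinearMap)
  have hw' : ∀ v, 2 * G p w v = φ v := fun v => by
    have : G p w v = (1 / 2) * φ v := congrArg (fun l => l v) hw
    rw [this]; ring
  refine ⟨w, fun Z hZ => (hw' _).trans (hφ Z hZ), fun w' h' => hinj ?_⟩
  ext v
  have h1 := h' (FiberBundle.extend E v) (FiberBundle.mdifferentiableAt_extend ..)
  rw [← hφ _ (FiberBundle.mdifferentiableAt_extend ..)] at h1
  simp only [FiberBundle.extend_apply_self] at h1
  have h2 := hw' v
  change G p w' v = G p w v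
  linarith

/-- The covariant derivative of a 1-form: `(∇_X β)(Y) = X(β(Y)) - β(∇_X Y)`, with respect to the
Levi-Civita connection of `G`. -/
def covDerivForm (G : ∀ p : M, TangentSpace I p → TangentSpace I p → ℝ)
    (β : ∀ p : M, TangentSpace I p →L[ℝ] ℝ) (X Y : ∀ p : M, TangentSpace I p) (p : M) : ℝ :=
  mvfderiv I (fun q => β q (Y q)) p (X p) - β p (leviCivita I G X Y p)

/-- `∇β = 0`, with respect to the Levi-Civita connection of `G`. -/
def IsParallelForm (G : ∀ p : M, TangentSpace I p → TangentSpace I p → ℝ)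
    (β : ∀ p : M, TangentSpace I p →L[ℝ] ℝ) : Prop :=
  ∀ (X Y : ∀ p : M, TangentSpace I p) (p : M), MDiffAt (T% X) p → MDiffAt (T% Y) p →
    covDerivForm I G β X Y p = 0

/-! ### Foliations of codimension one -/

variable (M) in
/-- A smooth foliation of codimension one, given by the hyperplane field tangent to its leaves:
locally the leaves are the level sets of a smooth real function without critical points, so that the
tangent hyperplane of the leaf is the kernel of the differential of this function. -/
structure CodimOneFoliation where
  tangent : ∀ p : M, Submodule ℝ (TangentSpace I p)
  locally_submersion : ∀ p : M, ∃ U : Set M, IsOpen U ∧ p ∈ U ∧ ∃ f : M → ℝ,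
    ContMDiffOn I 𝓘(ℝ, ℝ) ∞ f U ∧ ∀ q ∈ U, mvfderiv I f q ≠ 0 ∧
      ∀ u : TangentSpace I q, u ∈ tangent q ↔ mvfderiv I f q u = 0

/-! ### Randers spaces -/

variable [RiemannianBundle (fun p : M => TangentSpace I p)]

/-- The Riemannian metric `a = ⟨·, ·⟩` of the manifold, as a field of bilinear forms. -/
def riemannianMetric (p : M) (u v : TangentSpace I p) : ℝ := inner ℝ u v

/-- A smooth vector field `N` of `a`-unit length, `a`-orthogonal to the leaves. -/
structure IsUnitNormal (𝓕 : CodimOneFoliation I M) (N : ∀ p : M, TangentSpace I p) : Prop where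
  smooth : ContMDiff I I.tangent ∞ (T% N)
  unit : ∀ p, ‖N p‖ = 1
  orthogonal : ∀ p, ∀ u ∈ 𝓕.tangent p, inner ℝ (N p) u = 0

/-- A Randers datum: a smooth 1-form `β` whose `α`-norm (the dual norm of `α(y) = √⟨y, y⟩`) is
smaller than `1` at every point. -/
structure IsRandersForm (β : ∀ p : M, TangentSpace I p →L[ℝ] ℝ) : Prop where
  smooth : ContMDiff I (I.prod 𝓘(ℝ, E →L[ℝ] ℝ)) ∞
    (fun p => TotalSpace.mk' (E →L[ℝ] ℝ)
      (E := fun p => TangentSpace I p →L[ℝ] Bundle.Trivial M ℝ p) p (β p))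
  norm_lt_one : ∀ p, ‖β p‖ < 1

/-- The Randers norm `F(y) = √⟨y, y⟩ + β(y)` on the tangent space at `p`. -/
def randersNorm (β : ∀ p : M, TangentSpace I p →L[ℝ] ℝ) (p : M) (y : TangentSpace I p) : ℝ :=
  ‖y‖ + β p y

/-- The field of bilinear forms `g = g_n`, the fundamental tensor of the Randers norm in the
direction of the vector field `n`. -/
def normalMetric (β : ∀ p : M, TangentSpace I p →L[ℝ] ℝ) (n : ∀ p : M, TangentSpace I p)
    (p : M) (u v : TangentSpace I p) : ℝ :=
  fundamentalTensor (randersNorm I β p) (n p) u v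

/-- `n` is the `F`-normal of the foliation with `⟨n, n⟩ = 1`, on the same side of the leaves
as `N`. -/
structure IsFinslerNormal (𝓕 : CodimOneFoliation I M) (N : ∀ p : M, TangentSpace I p)
    (β : ∀ p : M, TangentSpace I p →L[ℝ] ℝ) (n : ∀ p : M, TangentSpace I p) : Prop where
  unit : ∀ p, ‖n p‖ = 1
  same_side : ∀ p, 0 < inner ℝ (n p) (N p)
  normal : ∀ p, ∀ u ∈ 𝓕.tangent p, normalMetric I β n p (n p) u = 0

/-- `Z̄ = ∇̄_N N`, the curvature vector of the `N`-curves for the metric `a`. -/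
def curvatureVector (N : ∀ p : M, TangentSpace I p) : ∀ p : M, TangentSpace I p :=
  leviCivita I (riemannianMetric I) N N

/-- The (1,1)-tensor `C_n^♯`, which is `g`-dual to the bilinear form `C_n(·, ·, ∇_n n)`; here
`g = g_n`, and `∇` is the Levi-Civita connection of `g`. -/
def cartanSharp (β : ∀ p : M, TangentSpace I p →L[ℝ] ℝ) (n : ∀ p : M, TangentSpace I p)
    (p : M) (u : TangentSpace I p) : TangentSpace I p :=
  dualVector (normalMetric I β n p) fun v =>
    cartanTorsion (randersNorm I β p) (n p) u v (leviCivita I (normalMetric I β n) n n p)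

end Manifold

end Randers

end

/-! Write `B` for the `a`-dual of `β`. For a unit vector `n` the Randers fundamental tensor
satisfies `g_n(n, ·) = (1 + β(n))(⟨n, ·⟩ + β)`, so `F`-normality says that the covector `⟨n, ·⟩ + β`
kills the leaf. Hence `n + B = cN` with `c = ⟨n, N⟩ + β(N)`, and `g_n(n, ·) = c²⟨n, N⟩⟨N, ·⟩`: the
new metric sees the same normal covector up to a factor.

The heart is `normalMetric_leviCivita`. Let `Z` be tangent to the leaves, `β(N) = k` constant, and
`|B|²` critical at the point. Since `⟨n, N⟩² = 1 + k² - |B|²`, the functions `⟨n, N⟩` and `g_n(n,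
n)` are critical too, and Koszul's formula leaves `g_n(∇_n n, Z) = g_n(n, [Z, n])`. Split `n = ⟨n,
N⟩N + (kN - B)`; the second summand is tangent, so its bracket with `Z` is tangent by involutivity.
As `⟨N, [Z, N]⟩ = ⟨Z̄, Z⟩`, the result is `g_n(∇_n n, Z) = c²⟨n, N⟩²⟨Z̄, Z⟩` with a positive factor.

The rest is algebra of the Cartan torsion. The form `C_n(·, ·, w)` vanishes when `w` is parallel to
`n`. Conversely, its vanishing forces `w` parallel to `n` or `β` proportional to `⟨n, ·⟩`, and the
latter makes `β` zero on the leaf. In (i) parallelism makes `|B|²` critical. In (ii) `|B|` is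
constant, and `β` vanishes on the leaf exactly where `|B|² = k²`, so everywhere or nowhere. -/

namespace Randers

/-! ### Algebra of a Randers norm on an inner product space. -/

section InnerProduct

variable {V : Type*} [NormedAddCommGroup V] [InnerProductSpace ℝ V]

local notation "⟪" x ", " y "⟫" => inner ℝ x y

theorem hasDerivAt_norm_line {y : V} (hy : y ≠ 0) (v : V) :
    HasDerivAt (fun t : ℝ => ‖y + t • v‖) (⟪y, v⟫ / ‖y‖) 0 := by
  have hl : HasDerivAt (fun t : ℝ => y + t • v) v 0 := by
    simpa using ((hasDerivAt_id (0 : ℝ)).smul_const v).const_add y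
  have h := hl.norm_sq.sqrt (by simpa using hy)
  simp only [zero_smul, add_zero, Real.sqrt_sq (norm_nonneg _)] at h
  convert h using 1
  field_simp

theorem hasDerivAt_linear_line (b : V →L[ℝ] ℝ) (y v : V) :
    HasDerivAt (fun t : ℝ => b (y + t • v)) (b v) 0 := by
  have : (fun t : ℝ => b (y + t • v)) = fun t => b y + t * b v := by
    ext t; simp
  rw [this]
  simpa using ((hasDerivAt_id (0 : ℝ)).mul_const (b v)).const_add (b y)

theorem hasDerivAt_inner_line (y u v : V) :
    HasDerivAt (fun t : ℝ => ⟪y + t • u, v⟫) ⟪u, v⟫ 0 := by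
  have : (fun t : ℝ => ⟪y + t • u, v⟫) = fun t => ⟪y, v⟫ + t * ⟪u, v⟫ := by
    ext t; simp [inner_add_left, inner_smul_left]
  rw [this]
  simpa using ((hasDerivAt_id (0 : ℝ)).mul_const ⟪u, v⟫).const_add ⟪y, v⟫

theorem eventually_line_ne_zero {y : V} (hy : y ≠ 0) (v : V) :
    ∀ᶠ t : ℝ in nhds 0, y + t • v ≠ 0 := by
  have : ContinuousAt (fun t : ℝ => y + t • v) 0 := by fun_prop
  exact this.eventually_ne (by simpa using hy)

theorem deriv_randers_sq (b : V →L[ℝ] ℝ) {y : V} (hy : y ≠ 0) (v : V) :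
    deriv (fun t : ℝ => (‖y + t • v‖ + b (y + t • v)) ^ 2) 0
      = 2 * ((‖y‖ + b y) * (⟪y, v⟫ / ‖y‖ + b v)) := by
  have h := ((hasDerivAt_norm_line hy v).add (hasDerivAt_linear_line b y v)).pow 2
  refine h.deriv.trans ?_
  simp
  ring

/-- The fundamental tensor of a Randers norm. -/
theorem fundamentalTensor_randers (b : V →L[ℝ] ℝ) {y : V} (hy : y ≠ 0) (u v : V) :
    fundamentalTensor (fun x => ‖x‖ + b x) y u v
      = (‖y‖ + b y) / ‖y‖ * (⟪u, v⟫ - ⟪y, u⟫ * ⟪y, v⟫ / ‖y‖ ^ 2)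
        + (⟪y, u⟫ / ‖y‖ + b u) * (⟪y, v⟫ / ‖y‖ + b v) := by
  unfold fundamentalTensor
  have hy' : ‖y‖ ≠ 0 := norm_ne_zero_iff.2 hy
  -- The inner derivative has a closed form only away from the origin; agreement near `s = 0`
  -- suffices for the outer derivative.
  have e : (fun s : ℝ => deriv (fun t : ℝ =>
      (‖y + s • u + t • v‖ + b (y + s • u + t • v)) ^ 2) 0) =ᶠ[nhds 0]
      fun s => 2 * ((‖y + s • u‖ + b (y + s • u)) * (⟪y + s • u, v⟫ / ‖y + s • u‖ + b v)) := by
    filter_upwards [eventually_line_ne_zero hy u] with s hs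
    exact deriv_randers_sq b hs v
  rw [e.deriv_eq]
  have h1 := hasDerivAt_norm_line hy u
  have h2 := hasDerivAt_linear_line b y u
  have h3 := hasDerivAt_inner_line y u v
  have h := (((h1.add h2).mul ((h3.div h1 (by simpa using hy)).add_const (b v))).const_mul 2)
  refine Eq.trans (congrArg _ h.deriv) ?_
  simp
  field_simp
  ring

/-- Each factor is a projection off `y`: the angular metric and the part of `b` orthogonal to `y`,
symmetrized over the three arguments. -/
theorem cartanTorsion_randers (b : V →L[ℝ] ℝ) {y : V} (hy : ‖y‖ = 1) (u v w : V) :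
    cartanTorsion (fun x => ‖x‖ + b x) y u v w
      = 1 / 2 * ((⟪u, v⟫ - ⟪y, u⟫ * ⟪y, v⟫) * (b w - b y * ⟪y, w⟫)
        + (⟪v, w⟫ - ⟪y, v⟫ * ⟪y, w⟫) * (b u - b y * ⟪y, u⟫)
        + (⟪w, u⟫ - ⟪y, w⟫ * ⟪y, u⟫) * (b v - b y * ⟪y, v⟫)) := by
  unfold cartanTorsion
  have hy0 : y ≠ 0 := by rintro rfl; simp at hy
  have e : (fun t : ℝ => fundamentalTensor (fun x => ‖x‖ + b x) (y + t • w) u v) =ᶠ[nhds 0]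
      fun t => (‖y + t • w‖ + b (y + t • w)) / ‖y + t • w‖
          * (⟪u, v⟫ - ⟪y + t • w, u⟫ * ⟪y + t • w, v⟫ / ‖y + t • w‖ ^ 2)
        + (⟪y + t • w, u⟫ / ‖y + t • w‖ + b u) * (⟪y + t • w, v⟫ / ‖y + t • w‖ + b v) := by
    filter_upwards [eventually_line_ne_zero hy0 w] with s hs
    exact fundamentalTensor_randers b hs u v
  rw [e.deriv_eq]
  have h1 := hasDerivAt_norm_line hy0 w
  have h2 := hasDerivAt_linear_line b y w
  have hu := hasDerivAt_inner_line y w u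
  have hv := hasDerivAt_inner_line y w v
  have hne : ‖y + (0 : ℝ) • w‖ ≠ 0 := by simpa using hy0
  have h := (((h1.add h2).div h1 hne).mul
    (((hu.mul hv).div (h1.pow 2) (pow_ne_zero 2 hne)).const_sub ⟪u, v⟫)).add
    (((hu.div h1 hne).add_const (b u)).mul ((hv.div h1 hne).add_const (b v)))
  refine Eq.trans (congrArg _ h.deriv) ?_
  simp [hy, real_inner_comm]
  ring

/-- The Cartan torsion `C_y(·, ·, w)` of a Randers norm vanishes if `w` is a multiple of `y`. -/
theorem cartanTorsion_randers_smul (b : V →L[ℝ] ℝ) {y : V} (hy : ‖y‖ = 1) (u v : V) (c : ℝ) :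
    cartanTorsion (fun x => ‖x‖ + b x) y u v (c • y) = 0 := by
  rw [cartanTorsion_randers b hy]
  simp [inner_smul_right, inner_smul_left, hy, real_inner_comm]
  ring

/-- If the Cartan torsion `C_y(·, ·, w)` of a Randers norm vanishes, then `w` is a multiple of `y`
or `b` is a multiple of `⟨y, ·⟩`. -/
theorem eq_smul_or_of_cartanTorsion_randers_eq_zero (b : V →L[ℝ] ℝ) {y : V} (hy : ‖y‖ = 1)
    {w : V} (h : ∀ u v, cartanTorsion (fun x => ‖x‖ + b x) y u v w = 0) :
    w = ⟪y, w⟫ • y ∨ ∀ v, b v = b y * ⟪y, v⟫ := by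
  simp only [cartanTorsion_randers b hy] at h
  set z := w - ⟪y, w⟫ • y with hz
  by_cases hz0 : z = 0
  · left; exact sub_eq_zero.1 hz0
  right
  have hyy : ⟪y, y⟫ = 1 := by simp [hy]
  have hyz : ⟪y, z⟫ = 0 := by simp [hz, inner_sub_right, inner_smul_right, hy]
  have hzz : 0 < ⟪z, z⟫ := real_inner_self_pos.2 hz0
  have hzw : ⟪z, w⟫ = ⟪z, z⟫ := by
    nth_rewrite 3 [hz]
    rw [inner_sub_right, inner_smul_right, real_inner_comm y z, hyz]; ring
  have hbz : b z = b w - b y * ⟪y, w⟫ := by simp [hz]; ring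
  -- With `u = v = z` the three terms coincide and give `(3/2)⟨z, z⟩ b(z)`. Once `b(z) = 0`, only
  -- the third term survives in the test on `(z, v)`.
  have hbw : b w - b y * ⟪y, w⟫ = 0 := by
    have := h z z
    rw [real_inner_comm z w, hzw, hyz, ← hbz] at this
    have h3 : ⟪z, z⟫ * b z = 0 := by linarith
    rw [← hbz]
    exact (mul_eq_zero.1 h3).resolve_left hzz.ne'
  intro v
  have := h z v
  rw [real_inner_comm z w, hzw, hyz, hbw, hbz, hbw] at this
  have h3 : ⟪z, z⟫ * (b v - b y * ⟪y, v⟫) = 0 := by linarith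
  exact sub_eq_zero.1 ((mul_eq_zero.1 h3).resolve_left hzz.ne')

/-- The fundamental tensor of a Randers norm in a unit direction. -/
theorem fundamentalTensor_randers_unit (b : V →L[ℝ] ℝ) {y : V} (hy : ‖y‖ = 1) (u v : V) :
    fundamentalTensor (fun x => ‖x‖ + b x) y u v
      = (1 + b y) * (⟪u, v⟫ - ⟪y, u⟫ * ⟪y, v⟫) + (⟪y, u⟫ + b u) * (⟪y, v⟫ + b v) := by
  rw [fundamentalTensor_randers b (by rintro rfl; simp at hy)]
  simp [hy]

theorem one_add_apply_pos (b : V →L[ℝ] ℝ) (hb : ‖b‖ < 1) {y : V} (hy : ‖y‖ = 1) : 0 < 1 + b y := by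
  have := b.le_opNorm y
  rw [hy, mul_one, Real.norm_eq_abs] at this
  linarith [neg_abs_le (b y)]

/-- Testing against `y` kills `⟨y, u⟩ + b(u)`. Testing against `u` then kills the part of `u`
orthogonal to `y`, and a multiple `ty` satisfies `t(1 + b(y)) = 0`. -/
theorem fundamentalTensor_randers_nondegenerate (b : V →L[ℝ] ℝ) (hb : ‖b‖ < 1) {y : V}
    (hy : ‖y‖ = 1) {u : V} (h : ∀ v, fundamentalTensor (fun x => ‖x‖ + b x) y u v = 0) : u = 0 := by
  have hpos := one_add_apply_pos b hb hy
  have hyy : ⟪y, y⟫ = 1 := by simp [hy]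
  have h1 := h y
  have h2 := h u
  rw [fundamentalTensor_randers_unit b hy] at h1 h2
  rw [hyy, real_inner_comm y u] at h1
  have h3 : ⟪y, u⟫ + b u = 0 := by
    have : (⟪y, u⟫ + b u) * (1 + b y) = 0 := by linarith
    exact (mul_eq_zero.1 this).resolve_right hpos.ne'
  set z := u - ⟪y, u⟫ • y with hz
  have hzz : ⟪z, z⟫ = ⟪u, u⟫ - ⟪y, u⟫ * ⟪y, u⟫ := by
    simp only [hz, inner_sub_left, inner_sub_right, inner_smul_left, inner_smul_right, hyy,
      real_inner_comm u y]
    simp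
  rw [h3, ← hzz] at h2
  have hz0 : z = 0 := by
    have : ⟪z, z⟫ = 0 := by
      have : (1 + b y) * ⟪z, z⟫ = 0 := by linarith
      exact (mul_eq_zero.1 this).resolve_left hpos.ne'
    exact inner_self_eq_zero.1 this
  have hu : u = ⟪y, u⟫ • y := sub_eq_zero.1 hz0
  have hbu : b u = ⟪y, u⟫ * b y := by nth_rewrite 1 [hu]; simp
  have : ⟪y, u⟫ * (1 + b y) = 0 := by rw [hbu] at h3; linarith
  rw [hu, (mul_eq_zero.1 this).resolve_right hpos.ne', zero_smul]

end InnerProduct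

/-! ### Involutivity of the kernel of a differential. -/

section Bracket

variable {E : Type*} [NormedAddCommGroup E] [NormedSpace ℝ E]

/-- If `V f` and `W f` vanish near `x`, then `[V, W] f` vanishes at `x`. -/
theorem fderiv_lieBracket_eq_zero {f : E → ℝ} {x : E} (hf : ContDiffAt ℝ 2 f x) {V W : E → E}
    (hV : DifferentiableAt ℝ V x) (hW : DifferentiableAt ℝ W x)
    (hVf : ∀ᶠ y in nhds x, fderiv ℝ f y (V y) = 0)
    (hWf : ∀ᶠ y in nhds x, fderiv ℝ f y (W y) = 0) :
    fderiv ℝ f x (lieBracket ℝ V W x) = 0 := by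
  have df : DifferentiableAt ℝ (fderiv ℝ f) x :=
    (hf.fderiv_right (m := 1) (by norm_num)).differentiableAt one_ne_zero
  -- The derivative of the identity `Df(U) = 0` in direction `v`. In the difference for `V` and `W`
  -- the Hessian terms cancel by symmetry.
  have key : ∀ U : E → E, DifferentiableAt ℝ U x → (∀ᶠ y in nhds x, fderiv ℝ f y (U y) = 0) →
      ∀ v : E, fderiv ℝ f x (fderiv ℝ U x v) + fderiv ℝ (fderiv ℝ f) x v (U x) = 0 := by
    intro U hU hUf v
    have h := (df.hasFDerivAt.clm_apply hU.hasFDerivAt).unique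
      (((hasFDerivAt_const (0 : ℝ) x)).congr_of_eventuallyEq hUf)
    exact congrArg (fun l => l v) h
  rw [lieBracket_eq]
  simp only [map_sub]
  have h1 := key V hV hVf (W x)
  have h2 := key W hW hWf (V x)
  have h3 := hf.isSymmSndFDerivAt (by simp) (V x) (W x)
  linarith

variable {H : Type*} [TopologicalSpace H] (I : ModelWithCorners ℝ E H) [I.Boundaryless]
  {M : Type*} [TopologicalSpace M] [ChartedSpace H M] [IsManifold I ∞ M]

theorem mvfderiv_vectorSpace (f : E → ℝ) (x v : E) :
    mvfderiv 𝓘(ℝ, E) f x v = fderiv ℝ f x v := by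
  simp only [mvfderiv, mfderiv_eq_fderiv]
  rfl

/-- If `X f` and `Y f` vanish near `p`, then `[X, Y] f` vanishes at `p`. -/
theorem mvfderiv_mlieBracket_eq_zero [CompleteSpace E] {f : M → ℝ} {p : M}
    (hf : ∀ᶠ q in nhds p, ContMDiffAt I 𝓘(ℝ, ℝ) ∞ f q) {X Y : ∀ q : M, TangentSpace I q}
    (hX : MDiffAt (T% X) p) (hY : MDiffAt (T% Y) p)
    (hXf : ∀ᶠ q in nhds p, mvfderiv I f q (X q) = 0)
    (hYf : ∀ᶠ q in nhds p, mvfderiv I f q (Y q) = 0) :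
    mvfderiv I f p (mlieBracket I X Y p) = 0 := by
  set φ := extChartAt I p with hφ
  have hr : Set.range I = Set.univ := I.range_eq_univ
  have htgt : ∀ᶠ x in nhds (φ p), x ∈ φ.target := extChartAt_target_mem_nhds p
  have hcont : Filter.Tendsto φ.symm (nhds (φ p)) (nhds p) := by
    have := continuousAt_extChartAt_symm (I := I) p
    rw [ContinuousAt, extChartAt_to_inv] at this
    exact this
  let fh : E → ℝ := f ∘ φ.symm
  have hfh : ContDiffAt ℝ 2 fh (φ p) := by
    have h2 : ContMDiffAt I 𝓘(ℝ, ℝ) 2 f p := hf.self_of_nhds.of_le (by norm_cast)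
    have h3 := (contMDiffAt_iff_source (I' := 𝓘(ℝ, ℝ))).1 h2
    rw [hr, contMDiffWithinAt_univ] at h3
    exact h3.contDiffAt
  -- Pulling back to the chart preserves the hypothesis: by the chain rule, the chart representative
  -- of `Z` annihilates that of `f`.
  have key : ∀ Z : ∀ q : M, TangentSpace I q, (∀ᶠ q in nhds p, mvfderiv I f q (Z q) = 0) →
      ∀ᶠ x in nhds (φ p), fderiv ℝ fh x
        (mpullbackWithin 𝓘(ℝ, E) I φ.symm Z (Set.range I) x) = 0 := by
    intro Z hZ
    filter_upwards [hcont.eventually hZ, hcont.eventually hf, htgt] with x h1 h2 h3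
    have hinv := isInvertible_mfderivWithin_extChartAt_symm (I := I) h3
    have hd : MDifferentiableAt 𝓘(ℝ, E) I φ.symm x := by
      have := mdifferentiableWithinAt_extChartAt_symm (I := I) h3
      rwa [hr, mdifferentiableWithinAt_univ] at this
    have hc := mvfderiv_comp_apply (I' := 𝓘(ℝ, E)) (I := I) x (h2.mdifferentiableAt (by simp)) hd
      (mpullbackWithin 𝓘(ℝ, E) I φ.symm Z (Set.range I) x)
    have he : mfderiv 𝓘(ℝ, E) I φ.symm x (mpullbackWithin 𝓘(ℝ, E) I φ.symm Z (Set.range I) x)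
        = Z (φ.symm x) := by
      rw [mpullbackWithin_apply, ← mfderivWithin_univ, ← hr]
      exact hinv.self_apply_inverse _
    rw [he, h1] at hc
    exact (mvfderiv_vectorSpace fh x _).symm.trans hc
  have dkey : ∀ Z : ∀ q : M, TangentSpace I q, MDiffAt (T% Z) p →
      DifferentiableAt ℝ (mpullbackWithin 𝓘(ℝ, E) I φ.symm Z (Set.range I) : E → E) (φ p) := by
    intro Z hZ
    have := MDifferentiableWithinAt.differentiableWithinAt_mpullbackWithin_vectorField
      (s := Set.univ) (hZ.mdifferentiableWithinAt)
    rw [Set.preimage_univ, Set.univ_inter] at this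
    exact this.differentiableAt (by rw [hr]; exact Filter.univ_mem)
  have hbr := fderiv_lieBracket_eq_zero hfh (dkey X hX) (dkey Y hY) (key X hXf) (key Y hYf)
  have hinv := isInvertible_mfderiv_extChartAt (I := I) (mem_extChartAt_source (I := I) p)
  have hdφ : MDifferentiableAt I 𝓘(ℝ, E) φ p := mdifferentiableAt_extChartAt (mem_chart_source H p)
  have hfe : f =ᶠ[nhds p] fh ∘ φ := by
    filter_upwards [extChartAt_source_mem_nhds (I := I) p] with q hq
    exact congrArg f ((extChartAt I p).left_inv hq).symm
  have hbr' : mfderiv I 𝓘(ℝ, E) φ p (mlieBracket I X Y p) = lieBracket ℝ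
      (mpullbackWithin 𝓘(ℝ, E) I φ.symm X (Set.range I) : E → E)
      (mpullbackWithin 𝓘(ℝ, E) I φ.symm Y (Set.range I)) (φ p) := by
    rw [← mlieBracketWithin_univ, mlieBracketWithin_apply, Set.preimage_univ, Set.univ_inter]
    refine (hinv.self_apply_inverse _).trans ?_
    have : ∀ V W : E → E, lieBracketWithin ℝ V W (Set.range I) (φ p) = lieBracket ℝ V W (φ p) := by
      intro V W
      rw [hr, lieBracketWithin_univ]
    exact this _ _
  have hmf : mvfderiv I f p = mvfderiv I (fh ∘ φ) p := by
    simp only [mvfderiv]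
    rw [hfe.mfderiv_eq]
    rfl
  rw [hmf, mvfderiv_comp_apply p
    (hfh.differentiableAt (by simp)).mdifferentiableAt hdφ, hbr']
  exact (mvfderiv_vectorSpace fh _ _).trans hbr

end Bracket

/-! ### Smoothness of the metric dual of a 1-form. -/

section Sharp

theorem contDiff_det_of_contDiff {ι W : Type*} [Fintype ι] [DecidableEq ι] [NormedAddCommGroup W]
    [NormedSpace ℝ W] {k : WithTop ℕ∞} {A : W → Matrix ι ι ℝ}
    (hA : ∀ i j, ContDiff ℝ k fun x => A x i j) : ContDiff ℝ k fun x => (A x).det := by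
  simp only [Matrix.det_apply]
  exact ContDiff.sum fun σ _ => (contDiff_prod fun i _ => hA _ _).const_smul _

theorem contDiff_adjugate_apply {ι : Type*} [Fintype ι] [DecidableEq ι] {k : WithTop ℕ∞} (i j : ι) :
    ContDiff ℝ k fun A : ι → ι → ℝ => (Matrix.of A).adjugate i j := by
  simp only [Matrix.adjugate_apply]
  refine contDiff_det_of_contDiff fun r s => ?_
  by_cases h : r = j
  · subst h; simpa using contDiff_const
  · simp only [Matrix.updateRow_ne h, Matrix.of_apply]
    fun_prop

/-- Cramer's rule: the adjugate and the determinant are polynomial in the entries. -/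
theorem contDiffAt_matrix_inv_apply {ι : Type*} [Fintype ι] [DecidableEq ι] {k : WithTop ℕ∞}
    {A : ι → ι → ℝ} (hA : (Matrix.of A).det ≠ 0) (i j : ι) :
    ContDiffAt ℝ k (fun A : ι → ι → ℝ => (Matrix.of A)⁻¹ i j) A := by
  simp only [Matrix.inv_def, Ring.inverse_eq_inv', Matrix.smul_apply, smul_eq_mul]
  refine ContDiffAt.mul (ContDiffAt.inv ?_ hA) (contDiff_adjugate_apply i j).contDiffAt
  exact (contDiff_det_of_contDiff fun i j => by simp only [Matrix.of_apply]; fun_prop).contDiffAt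

variable {E : Type*} [NormedAddCommGroup E] [NormedSpace ℝ E]
  {H : Type*} [TopologicalSpace H] (I : ModelWithCorners ℝ E H)
  {M : Type*} [TopologicalSpace M] [ChartedSpace H M] [IsManifold I ∞ M]
  [RiemannianBundle (fun p : M => TangentSpace I p)]

theorem IsRandersForm.contMDiffAt_apply {β : ∀ p : M, TangentSpace I p →L[ℝ] ℝ}
    (hβ : IsRandersForm I β) {k : WithTop ℕ∞} (hk : k ≤ ∞) {Y : ∀ p : M, TangentSpace I p} {p : M}
    (hY : ContMDiffAt I I.tangent k (T% Y) p) :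
    ContMDiffAt I 𝓘(ℝ, ℝ) k (fun q => β q (Y q)) p := by
  have := ContMDiffAt.clm_bundle_apply (F₁ := E) (F₂ := ℝ) (E₂ := Bundle.Trivial M ℝ)
    ((hβ.smooth p).of_le hk) hY
  exact (contMDiffAt_totalSpace.1 this).2

theorem IsRandersForm.mdifferentiableAt_apply {β : ∀ p : M, TangentSpace I p →L[ℝ] ℝ}
    (hβ : IsRandersForm I β) {Y : ∀ p : M, TangentSpace I p} {p : M}
    (hY : MDiffAt (T% Y) p) : MDiffAt (fun q => β q (Y q)) p := by
  have := MDifferentiableAt.clm_bundle_apply (F₁ := E) (F₂ := ℝ) (E₂ := Bundle.Trivial M ℝ)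
    ((hβ.smooth p).mdifferentiableAt (by simp)) hY
  exact ((mdifferentiableAt_totalSpace ..).1 this).2

variable [FiniteDimensional ℝ E] [IsContMDiffRiemannianBundle I ∞ E (fun p : M => TangentSpace I p)]

/-- The vector field dual to a smooth 1-form is smooth. -/
theorem IsRandersForm.contMDiffAt_dual {β : ∀ p : M, TangentSpace I p →L[ℝ] ℝ}
    (hβ : IsRandersForm I β) {B : ∀ p : M, TangentSpace I p}
    (hB : ∀ p v, inner ℝ (B p) v = β p v) (p : M) :
    ContMDiffAt I I.tangent ∞ (T% B) p := by
  classical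
  let e := trivializationAt E (TangentSpace I : M → Type _) p
  have hp : p ∈ e.baseSet := FiberBundle.mem_baseSet_trivializationAt' p
  let b := Module.finBasis ℝ E
  let s := e.localFrame b
  have hs : IsLocalFrameOn I E ∞ s e.baseSet := e.isLocalFrameOn_localFrame_baseSet I ∞ b
  have hsm : ∀ i, ContMDiffAt I I.tangent ∞ (T% (s i)) p := fun i =>
    hs.contMDiffAt e.open_baseSet hp i
  let A : M → Fin (Module.finrank ℝ E) → Fin (Module.finrank ℝ E) → ℝ :=
    fun q i j => inner ℝ (s i q) (s j q)
  have hA : ContMDiffAt I 𝓘(ℝ, Fin (Module.finrank ℝ E) → Fin (Module.finrank ℝ E) → ℝ) ∞ A p :=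
    contMDiffAt_pi_space.2 fun i => contMDiffAt_pi_space.2 fun j =>
      ContMDiffAt.inner_bundle (hsm i) (hsm j)
  have hdet : ∀ q ∈ e.baseSet, (Matrix.of (A q)).det ≠ 0 := fun q hq =>
    (Matrix.posDef_gram_of_linearIndependent (𝕜 := ℝ) (hs.linearIndependent hq)).det_pos.ne'
  refine hs.contMDiffAt_of_coeff_aux (fun i => ?_) e.open_baseSet hp
  -- The frame coefficients of `B` solve a linear system whose matrix is the Gram matrix of the
  -- frame and whose right-hand side is `β` on the frame.
  have hc : ∀ q ∈ e.baseSet, hs.coeff i q (B q)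
      = ∑ j, (Matrix.of (A q))⁻¹ i j * β q (s j q) := by
    intro q hq
    have h1 : (Matrix.of (A q)).mulVec (fun j => hs.coeff j q (B q)) = fun j => β q (s j q) := by
      ext j
      rw [← hB, real_inner_comm]
      nth_rewrite 2 [hs.coeff_sum_eq B hq]
      rw [inner_sum]
      simp [Matrix.mulVec, dotProduct, A, inner_smul_right, mul_comm]
    have h2 := congrArg ((Matrix.of (A q))⁻¹).mulVec h1
    rw [Matrix.mulVec_mulVec, Matrix.nonsing_inv_mul _ (hdet q hq).isUnit, Matrix.one_mulVec] at h2
    exact congrFun h2 i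
  have hsum : ContMDiffAt I 𝓘(ℝ, ℝ) ∞
      (fun q => ∑ j, (Matrix.of (A q))⁻¹ i j * β q (s j q)) p := by
    refine ContMDiffAt.sum fun j _ => ?_
    refine ContMDiffAt.mul ?_ (hβ.contMDiffAt_apply I le_rfl (hsm j))
    exact (contDiffAt_matrix_inv_apply (hdet p hp) i j).contMDiffAt.comp p hA
  refine hsum.congr_of_eventuallyEq ?_
  filter_upwards [e.open_baseSet.mem_nhds hp] with q hq
  exact hc q hq

end Sharp

/-! ### Pointwise relations between `N`, `n`, `β` and `g_n`. -/

section Pointwise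

variable {E : Type*} [NormedAddCommGroup E] [NormedSpace ℝ E]
  {H : Type*} [TopologicalSpace H] (I : ModelWithCorners ℝ E H)
  {M : Type*} [TopologicalSpace M] [ChartedSpace H M]
  [RiemannianBundle (fun p : M => TangentSpace I p)]

local notation "⟪" x ", " y "⟫" => inner ℝ x y

theorem normalMetric_apply {β : ∀ p : M, TangentSpace I p →L[ℝ] ℝ}
    {n : ∀ p : M, TangentSpace I p} {p : M} (hn : ‖n p‖ = 1) (u v : TangentSpace I p) :
    normalMetric I β n p u v = (1 + β p (n p)) * (⟪u, v⟫ - ⟪n p, u⟫ * ⟪n p, v⟫)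
      + (⟪n p, u⟫ + β p u) * (⟪n p, v⟫ + β p v) :=
  fundamentalTensor_randers_unit (β p) hn u v

variable {I} {𝓕 : CodimOneFoliation I M} {N : ∀ p : M, TangentSpace I p}
  {β : ∀ p : M, TangentSpace I p →L[ℝ] ℝ} {n : ∀ p : M, TangentSpace I p}

theorem IsFinslerNormal.normalMetric_symm (hn : IsFinslerNormal I 𝓕 N β n) (p : M)
    (u v : TangentSpace I p) : normalMetric I β n p u v = normalMetric I β n p v u := by
  rw [normalMetric_apply I (hn.unit p), normalMetric_apply I (hn.unit p), real_inner_comm u v]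
  ring

theorem IsFinslerNormal.normalMetric_add (hn : IsFinslerNormal I 𝓕 N β n) (p : M)
    (u u' v : TangentSpace I p) :
    normalMetric I β n p (u + u') v = normalMetric I β n p u v + normalMetric I β n p u' v := by
  simp only [normalMetric_apply I (hn.unit p), inner_add_left, inner_add_right, map_add]
  ring

theorem IsFinslerNormal.normalMetric_smul (hn : IsFinslerNormal I 𝓕 N β n) (p : M) (a : ℝ)
    (u v : TangentSpace I p) :
    normalMetric I β n p (a • u) v = a * normalMetric I β n p u v := by
  simp only [normalMetric_apply I (hn.unit p), real_inner_smul_left, inner_smul_right, map_smul,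
    smul_eq_mul]
  ring

variable [IsManifold I ∞ M]

theorem IsUnitNormal.inner_self (hN : IsUnitNormal I 𝓕 N) (p : M) : ⟪N p, N p⟫ = (1 : ℝ) := by
  simp [hN.unit p]

/-- The tangent hyperplane of a leaf is the orthogonal complement of the unit normal. -/
theorem IsUnitNormal.mem_tangent_iff (hN : IsUnitNormal I 𝓕 N) {p : M} {u : TangentSpace I p} :
    u ∈ 𝓕.tangent p ↔ ⟪N p, u⟫ = (0 : ℝ) := by
  refine ⟨hN.orthogonal p u, fun hu => ?_⟩
  obtain ⟨U, -, hpU, f, -, hf⟩ := 𝓕.locally_submersion p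
  have hker := (hf p hpU).2
  have hNN := hN.inner_self p
  have hfN : mvfderiv I f p (N p) ≠ 0 := fun h => by
    have := hN.orthogonal p _ ((hker _).2 h)
    rw [this] at hNN
    exact zero_ne_one hNN
  -- The projection of `u` to the leaf along `N`; orthogonality to `N` then forces the subtracted
  -- coefficient to be zero.
  have hmem : u - (mvfderiv I f p u / mvfderiv I f p (N p)) • N p ∈ 𝓕.tangent p := by
    rw [hker, map_sub, map_smul, smul_eq_mul, div_mul_cancel₀ _ hfN, sub_self]
  have h := hN.orthogonal p _ hmem
  rw [inner_sub_right, inner_smul_right, hNN, hu, mul_one, zero_sub, neg_eq_zero] at h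
  rwa [h, zero_smul, sub_zero] at hmem

theorem IsRandersForm.one_add_apply_pos (hβ : IsRandersForm I β)
    (hn : IsFinslerNormal I 𝓕 N β n) (p : M) : 0 < 1 + β p (n p) :=
  Randers.one_add_apply_pos (β p) (hβ.norm_lt_one p) (hn.unit p)

/-- The factor `c` such that `⟨n, ·⟩ + β = c ⟨N, ·⟩`. -/
noncomputable def conormalFactor (β : ∀ p : M, TangentSpace I p →L[ℝ] ℝ) (N n : ∀ p : M, TangentSpace I p)
    (p : M) : ℝ :=
  ⟪n p, N p⟫ + β p (N p)

/-- The vector field dual to `β`, expressed through the two normals of the foliation. -/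
noncomputable def dualField (β : ∀ p : M, TangentSpace I p →L[ℝ] ℝ) (N n : ∀ p : M, TangentSpace I p)
    (p : M) : TangentSpace I p :=
  conormalFactor β N n p • N p - n p

/-- Since `g_n(n, ·) = (1 + β(n))(⟨n, ·⟩ + β)` with a positive factor, the covector `⟨n, ·⟩ + β`
vanishes on the leaf, hence is a multiple of `⟨N, ·⟩`; its value at `N` gives the factor. -/
theorem IsFinslerNormal.inner_add_apply (hn : IsFinslerNormal I 𝓕 N β n) (hβ : IsRandersForm I β)
    (hN : IsUnitNormal I 𝓕 N) (p : M) (u : TangentSpace I p) :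
    ⟪n p, u⟫ + β p u = conormalFactor β N n p * ⟪N p, u⟫ := by
  have hnn : ⟪n p, n p⟫ = (1 : ℝ) := by simp [hn.unit p]
  have hmem : u - ⟪N p, u⟫ • N p ∈ 𝓕.tangent p := by
    rw [hN.mem_tangent_iff, inner_sub_right, inner_smul_right, hN.inner_self, mul_one, sub_self]
  have h := hn.normal p _ hmem
  rw [normalMetric_apply I (hn.unit p), hnn, one_mul, sub_self, mul_zero, zero_add] at h
  have h' := (mul_eq_zero.1 h).resolve_left (hβ.one_add_apply_pos hn p).ne'
  rw [inner_sub_right, inner_smul_right, map_sub, map_smul, smul_eq_mul] at h'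
  rw [conormalFactor]
  linarith

theorem IsFinslerNormal.inner_dualField (hn : IsFinslerNormal I 𝓕 N β n) (hβ : IsRandersForm I β)
    (hN : IsUnitNormal I 𝓕 N) (p : M) (u : TangentSpace I p) :
    ⟪dualField β N n p, u⟫ = β p u := by
  rw [dualField, inner_sub_left, real_inner_smul_left, ← hn.inner_add_apply hβ hN]
  ring

theorem IsFinslerNormal.one_add_apply (hn : IsFinslerNormal I 𝓕 N β n) (hβ : IsRandersForm I β)
    (hN : IsUnitNormal I 𝓕 N) (p : M) :
    1 + β p (n p) = conormalFactor β N n p * ⟪n p, N p⟫ := by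
  have h := hn.inner_add_apply hβ hN p (n p)
  have hnn : ⟪n p, n p⟫ = (1 : ℝ) := by simp [hn.unit p]
  rwa [hnn, real_inner_comm] at h

theorem IsFinslerNormal.conormalFactor_pos (hn : IsFinslerNormal I 𝓕 N β n)
    (hβ : IsRandersForm I β) (hN : IsUnitNormal I 𝓕 N) (p : M) : 0 < conormalFactor β N n p := by
  have h := hβ.one_add_apply_pos hn p
  rw [hn.one_add_apply hβ hN] at h
  exact pos_of_mul_pos_left h (hn.same_side p).le

/-- The squared cosine of the angle between `n` and `N`. -/
theorem IsFinslerNormal.inner_sq (hn : IsFinslerNormal I 𝓕 N β n) (hβ : IsRandersForm I β)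
    (hN : IsUnitNormal I 𝓕 N) (p : M) :
    ⟪n p, N p⟫ ^ 2 = 1 + β p (N p) ^ 2 - ⟪dualField β N n p, dualField β N n p⟫ := by
  have hnn : ⟪n p, n p⟫ = (1 : ℝ) := by simp [hn.unit p]
  rw [hn.inner_dualField hβ hN]
  have h1 := hn.one_add_apply hβ hN p
  simp only [dualField, map_sub, map_smul, smul_eq_mul]
  have h2 : β p (n p) = conormalFactor β N n p * ⟪n p, N p⟫ - 1 := by linarith
  rw [h2, conormalFactor]
  ring

/-- Regularity of `n` is not assumed. This formula expresses `⟨n, N⟩` through `N` and the dual of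
`β`, both smooth, and so yields differentiability of `n`. -/
theorem IsFinslerNormal.inner_eq_sqrt (hn : IsFinslerNormal I 𝓕 N β n) (hβ : IsRandersForm I β)
    (hN : IsUnitNormal I 𝓕 N) (p : M) :
    ⟪n p, N p⟫ = √(1 + β p (N p) ^ 2 - ⟪dualField β N n p, dualField β N n p⟫) := by
  rw [← hn.inner_sq hβ hN, Real.sqrt_sq (hn.same_side p).le]

theorem IsFinslerNormal.normalMetric_left (hn : IsFinslerNormal I 𝓕 N β n)
    (hβ : IsRandersForm I β) (hN : IsUnitNormal I 𝓕 N) (p : M) (u : TangentSpace I p) :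
    normalMetric I β n p (n p) u = conormalFactor β N n p ^ 2 * ⟪n p, N p⟫ * ⟪N p, u⟫ := by
  have hnn : ⟪n p, n p⟫ = (1 : ℝ) := by simp [hn.unit p]
  rw [normalMetric_apply I (hn.unit p), hnn, one_mul, sub_self, mul_zero, zero_add,
    hn.inner_add_apply hβ hN, hn.one_add_apply hβ hN]
  ring

theorem IsFinslerNormal.normalMetric_nondegenerate (hn : IsFinslerNormal I 𝓕 N β n)
    (hβ : IsRandersForm I β) {p : M} (u : TangentSpace I p)
    (h : ∀ v, normalMetric I β n p u v = 0) : u = 0 :=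
  fundamentalTensor_randers_nondegenerate (β p) (hβ.norm_lt_one p) (hn.unit p) h

/-- A vector which is `g`-orthogonal to the leaf is a multiple of `n`. -/
theorem IsFinslerNormal.eq_smul_of_normalMetric_eq_zero (hn : IsFinslerNormal I 𝓕 N β n)
    (hβ : IsRandersForm I β) (hN : IsUnitNormal I 𝓕 N) {p : M} {w : TangentSpace I p}
    (h : ∀ v ∈ 𝓕.tangent p, normalMetric I β n p w v = 0) : ∃ a : ℝ, w = a • n p := by
  have hc := (hn.same_side p).ne'
  have hdec : ∀ v : TangentSpace I p, ∃ a : ℝ, v - a • n p ∈ 𝓕.tangent p := fun v =>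
    ⟨⟪N p, v⟫ / ⟪n p, N p⟫, by
      rw [hN.mem_tangent_iff, inner_sub_right, inner_smul_right, real_inner_comm (n p) (N p),
        div_mul_cancel₀ _ hc, sub_self]⟩
  obtain ⟨a, ha⟩ := hdec w
  have hsub : ∀ x y v : TangentSpace I p, ∀ b : ℝ, normalMetric I β n p (x - b • y) v
      = normalMetric I β n p x v - b * normalMetric I β n p y v := fun x y v b => by
    rw [sub_eq_add_neg, ← neg_smul, hn.normalMetric_add, hn.normalMetric_smul]; ring
  refine ⟨a, sub_eq_zero.1 (hn.normalMetric_nondegenerate hβ _ fun v => ?_)⟩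
  obtain ⟨b, hb⟩ := hdec v
  have h1 : normalMetric I β n p (w - a • n p) (v - b • n p) = 0 := by
    rw [hsub, h _ hb, hn.normal p _ hb, mul_zero, sub_zero]
  rw [hn.normalMetric_symm, hsub, hn.normal p _ ha, mul_zero, sub_zero,
    hn.normalMetric_symm] at h1
  exact h1

end Pointwise

/-! ### Levi-Civita connections and the formula for `∇_n n`. -/

section Differential

variable {E : Type*} [NormedAddCommGroup E] [NormedSpace ℝ E]
  {H : Type*} [TopologicalSpace H] {I : ModelWithCorners ℝ E H}
  {M : Type*} [TopologicalSpace M] [ChartedSpace H M]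

/-- The function `f` is differentiable at `p` with vanishing differential. -/
def IsCriticalAt (I : ModelWithCorners ℝ E H) (f : M → ℝ) (p : M) : Prop :=
  MDiffAt f p ∧ mvfderiv I f p = 0

theorem IsCriticalAt.comp {f : M → ℝ} {p : M} (hf : IsCriticalAt I f p) {h : ℝ → ℝ}
    (hh : DifferentiableAt ℝ h (f p)) : IsCriticalAt I (fun q => h (f q)) p := by
  refine ⟨hh.comp_mdifferentiableAt hf.1, ?_⟩
  ext v
  have := mvfderiv_comp_apply (I := 𝓘(ℝ, ℝ)) (I' := I) p hh.mdifferentiableAt hf.1 v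
  have h0 : mfderiv I 𝓘(ℝ, ℝ) f p v = 0 := congrArg (fun l => l v) hf.2
  rw [h0, map_zero] at this
  exact this

variable [IsManifold I ∞ M] [RiemannianBundle (fun p : M => TangentSpace I p)]

local notation "⟪" x ", " y "⟫" => inner ℝ x y

variable {𝓕 : CodimOneFoliation I M} {N : ∀ p : M, TangentSpace I p}
  {β : ∀ p : M, TangentSpace I p →L[ℝ] ℝ} {n : ∀ p : M, TangentSpace I p}

/-- The tangent distribution of a foliation is involutive. -/
theorem IsUnitNormal.inner_mlieBracket_eq_zero [I.Boundaryless] [CompleteSpace E]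
    (hN : IsUnitNormal I 𝓕 N)
    {X Y : ∀ q : M, TangentSpace I q} {p : M} (hX : MDiffAt (T% X) p) (hY : MDiffAt (T% Y) p)
    (hXt : ∀ q, ⟪N q, X q⟫ = (0 : ℝ)) (hYt : ∀ q, ⟪N q, Y q⟫ = (0 : ℝ)) :
    ⟪N p, mlieBracket I X Y p⟫ = (0 : ℝ) := by
  obtain ⟨U, hU, hpU, f, hfs, hf⟩ := 𝓕.locally_submersion p
  rw [← hN.mem_tangent_iff, (hf p hpU).2]
  have hUn := hU.mem_nhds hpU
  refine mvfderiv_mlieBracket_eq_zero I ?_ hX hY ?_ ?_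
  · filter_upwards [hUn] with q hq
    exact (hfs q hq).contMDiffAt (hU.mem_nhds hq)
  · filter_upwards [hUn] with q hq
    exact ((hf q hq).2 _).1 (hN.mem_tangent_iff.2 (hXt q))
  · filter_upwards [hUn] with q hq
    exact ((hf q hq).2 _).1 (hN.mem_tangent_iff.2 (hYt q))

theorem IsUnitNormal.mdifferentiableAt (hN : IsUnitNormal I 𝓕 N) (p : M) : MDiffAt (T% N) p :=
  (hN.smooth p).mdifferentiableAt (by simp)

variable [IsContMDiffRiemannianBundle I ∞ E (fun p : M => TangentSpace I p)]

theorem mdifferentiableAt_inner {X Y : ∀ q : M, TangentSpace I q} {p : M}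
    (hX : MDiffAt (T% X) p) (hY : MDiffAt (T% Y) p) :
    MDiffAt (fun q => (⟪X q, Y q⟫ : ℝ)) p :=
  MDifferentiableAt.inner_bundle hX hY

/-- A vector tangent to a leaf extends to a differentiable field tangent to the leaves. -/
theorem IsUnitNormal.exists_tangent_extension (hN : IsUnitNormal I 𝓕 N) {p : M}
    {v : TangentSpace I p} (hv : v ∈ 𝓕.tangent p) :
    ∃ Z : ∀ q : M, TangentSpace I q, MDiffAt (T% Z) p ∧ Z p = v ∧ ∀ q, ⟪N q, Z q⟫ = (0 : ℝ) := by
  have hE : MDiffAt (T% (FiberBundle.extend E v)) p := FiberBundle.mdifferentiableAt_extend ..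
  refine ⟨fun q => FiberBundle.extend E v q - (⟪N q, FiberBundle.extend E v q⟫ : ℝ) • N q,
    ?_, ?_, fun q => ?_⟩
  · exact mdifferentiableAt_sub_section hE
      ((mdifferentiableAt_inner (hN.mdifferentiableAt p) hE).smul_section (hN.mdifferentiableAt p))
  · simp [hN.orthogonal p v hv]
  · rw [inner_sub_right, inner_smul_right, hN.inner_self, mul_one, sub_self]

variable [FiniteDimensional ℝ E]

/-- The defining property of the Levi-Civita connection of the Riemannian metric. -/
theorem leviCivita_riemannianMetric_spec {X Y Z : ∀ q : M, TangentSpace I q} {p : M}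
    (hX : MDiffAt (T% X) p) (hY : MDiffAt (T% Y) p) (hZ : MDiffAt (T% Z) p) :
    2 * ⟪leviCivita I (riemannianMetric I) X Y p, Z p⟫
      = koszul I (riemannianMetric I) X Y Z p := by
  have h := existsUnique_koszul I (G := riemannianMetric I) (p := p)
    (fun q u v => real_inner_comm v u) (fun q u u' v => inner_add_left u u' v)
    (fun q a u v => real_inner_smul_left u v a)
    (fun u hu => inner_self_eq_zero.1 (hu u)) (fun Y Z hY hZ => mdifferentiableAt_inner hY hZ) hX hY
  exact Classical.epsilon_spec h.exists Z hZ

theorem IsFinslerNormal.contMDiffAt_dualField (hn : IsFinslerNormal I 𝓕 N β n)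
    (hβ : IsRandersForm I β) (hN : IsUnitNormal I 𝓕 N) (p : M) :
    ContMDiffAt I I.tangent ∞ (T% (dualField β N n)) p :=
  hβ.contMDiffAt_dual I (hn.inner_dualField hβ hN) p

theorem IsFinslerNormal.mdifferentiableAt_dualField (hn : IsFinslerNormal I 𝓕 N β n)
    (hβ : IsRandersForm I β) (hN : IsUnitNormal I 𝓕 N) (p : M) :
    MDiffAt (T% (dualField β N n)) p :=
  (hn.contMDiffAt_dualField hβ hN p).mdifferentiableAt (by simp)

theorem IsFinslerNormal.mdifferentiableAt_inner (hn : IsFinslerNormal I 𝓕 N β n)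
    (hβ : IsRandersForm I β) (hN : IsUnitNormal I 𝓕 N) (p : M) :
    MDiffAt (fun q => (⟪n q, N q⟫ : ℝ)) p := by
  have hB := hn.mdifferentiableAt_dualField hβ hN p
  have h1 := Randers.mdifferentiableAt_inner hB hB
  have h2 := hβ.mdifferentiableAt_apply I (hN.mdifferentiableAt p)
  have h3 : (fun q => (⟪n q, N q⟫ : ℝ))
      = fun q => √(1 + β q (N q) ^ 2 - ⟪dualField β N n q, dualField β N n q⟫) :=
    funext fun q => hn.inner_eq_sqrt hβ hN q
  -- The radicand is `⟨n, N⟩²`, which is positive, so the square root is differentiable there.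
  have hpos : 1 + β p (N p) ^ 2 - ⟪dualField β N n p, dualField β N n p⟫ ≠ 0 := by
    rw [← hn.inner_sq hβ hN]
    exact (pow_pos (hn.same_side p) 2).ne'
  have hd : DifferentiableAt ℝ (fun x : ℝ × ℝ => √(1 + x.1 ^ 2 - x.2))
      (β p (N p), ⟪dualField β N n p, dualField β N n p⟫) := by
    refine DifferentiableAt.sqrt (by fun_prop) hpos
  rw [h3]
  exact hd.comp_mdifferentiableAt (x := p)
    (f := fun q => (β q (N q), (⟪dualField β N n q, dualField β N n q⟫ : ℝ))) (h2.prodMk_space h1)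

theorem IsFinslerNormal.mdifferentiableAt (hn : IsFinslerNormal I 𝓕 N β n)
    (hβ : IsRandersForm I β) (hN : IsUnitNormal I 𝓕 N) (p : M) : MDiffAt (T% n) p := by
  have hc : MDiffAt (conormalFactor β N n) p :=
    (hn.mdifferentiableAt_inner hβ hN p).add (hβ.mdifferentiableAt_apply I (hN.mdifferentiableAt p))
  have e : n = fun q => conormalFactor β N n q • N q - dualField β N n q := by
    ext q
    simp [dualField]
  rw [e]
  exact mdifferentiableAt_sub_section (hc.smul_section (hN.mdifferentiableAt p))
    (hn.mdifferentiableAt_dualField hβ hN p)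

/-- The defining property of the Levi-Civita connection of the metric `g_n`. -/
theorem IsFinslerNormal.leviCivita_spec (hn : IsFinslerNormal I 𝓕 N β n)
    (hβ : IsRandersForm I β) (hN : IsUnitNormal I 𝓕 N) {X Y Z : ∀ q : M, TangentSpace I q} {p : M}
    (hX : MDiffAt (T% X) p) (hY : MDiffAt (T% Y) p) (hZ : MDiffAt (T% Z) p) :
    2 * normalMetric I β n p (leviCivita I (normalMetric I β n) X Y p) (Z p)
      = koszul I (normalMetric I β n) X Y Z p := by
  have h := existsUnique_koszul I (G := normalMetric I β n) (p := p)
    hn.normalMetric_symm hn.normalMetric_add hn.normalMetric_smul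
    (hn.normalMetric_nondegenerate hβ) (fun Y Z hY hZ => by
      have e : (fun q => normalMetric I β n q (Y q) (Z q))
          = fun q => (1 + β q (n q)) * (⟪Y q, Z q⟫ - ⟪n q, Y q⟫ * ⟪n q, Z q⟫)
            + (⟪n q, Y q⟫ + β q (Y q)) * (⟪n q, Z q⟫ + β q (Z q)) :=
        funext fun q => normalMetric_apply I (hn.unit q) _ _
      have hnd := hn.mdifferentiableAt hβ hN p
      have h1 := Randers.mdifferentiableAt_inner hY hZ
      have h2 := Randers.mdifferentiableAt_inner hnd hY
      have h3 := Randers.mdifferentiableAt_inner hnd hZ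
      have h4 := hβ.mdifferentiableAt_apply I hnd
      have h5 := hβ.mdifferentiableAt_apply I hY
      have h6 := hβ.mdifferentiableAt_apply I hZ
      rw [e]
      exact ((mdifferentiableAt_const.add h4).mul (h1.sub (h2.mul h3))).add
        ((h2.add h5).mul (h3.add h6))) hX hY
  exact Classical.epsilon_spec h.exists Z hZ

/-- All inner products differentiated in Koszul's formula are constant, so only the two equal
bracket terms remain. -/
theorem IsUnitNormal.inner_curvatureVector (hN : IsUnitNormal I 𝓕 N)
    {Z : ∀ q : M, TangentSpace I q} {p : M} (hZ : MDiffAt (T% Z) p)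
    (hZt : ∀ q, ⟪N q, Z q⟫ = (0 : ℝ)) :
    ⟪curvatureVector I N p, Z p⟫ = (⟪N p, mlieBracket I Z N p⟫ : ℝ) := by
  have h := leviCivita_riemannianMetric_spec (hN.mdifferentiableAt p) (hN.mdifferentiableAt p) hZ
  have hZt' : ∀ q, ⟪Z q, N q⟫ = (0 : ℝ) := fun q => by rw [real_inner_comm, hZt]
  simp only [koszul, riemannianMetric, hZt, hZt', hN.inner_self, mvfderiv_const,
    mlieBracket_self] at h
  rw [mlieBracket_swap_apply (V := N) (W := Z)] at h
  simp [inner_neg_left] at h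
  rw [real_inner_comm (mlieBracket I Z N p)]
  unfold curvatureVector
  linarith

theorem IsUnitNormal.inner_curvatureVector_self (hN : IsUnitNormal I 𝓕 N) (p : M) :
    ⟪curvatureVector I N p, N p⟫ = (0 : ℝ) := by
  have h := leviCivita_riemannianMetric_spec (hN.mdifferentiableAt p) (hN.mdifferentiableAt p)
    (hN.mdifferentiableAt p)
  simp only [koszul, riemannianMetric, hN.inner_self, mvfderiv_const, mlieBracket_self] at h
  simp at h
  exact h

/-- When `β(N)` is constant and `p` is a critical point of the squared norm of `β`, the leafwise
part of `∇_n n` for `g_n` is proportional to that of `∇̄_N N`. -/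
theorem IsFinslerNormal.normalMetric_leviCivita [I.Boundaryless] (hn : IsFinslerNormal I 𝓕 N β n)
    (hβ : IsRandersForm I β) (hN : IsUnitNormal I 𝓕 N) {k : ℝ} (hk : ∀ q, β q (N q) = k) {p : M}
    (hcrit : IsCriticalAt I (fun q => (⟪dualField β N n q, dualField β N n q⟫ : ℝ)) p)
    {v : TangentSpace I p} (hv : v ∈ 𝓕.tangent p) :
    normalMetric I β n p (leviCivita I (normalMetric I β n) n n p) v
      = conormalFactor β N n p ^ 2 * ⟪n p, N p⟫ ^ 2 * ⟪curvatureVector I N p, v⟫ := by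
  have : CompleteSpace E := FiniteDimensional.complete ℝ E
  obtain ⟨Z, hZ, rfl, hZt⟩ := hN.exists_tangent_extension hv
  have hnd := hn.mdifferentiableAt hβ hN p
  have hNd := hN.mdifferentiableAt p
  have hBd := hn.mdifferentiableAt_dualField hβ hN p
  have hcos : IsCriticalAt I (fun q => (⟪n q, N q⟫ : ℝ)) p := by
    have e : (fun q => (⟪n q, N q⟫ : ℝ))
        = fun q => √(1 + k ^ 2 - ⟪dualField β N n q, dualField β N n q⟫) :=
      funext fun q => by rw [hn.inner_eq_sqrt hβ hN, hk]
    rw [e]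
    refine hcrit.comp (h := fun t => √(1 + k ^ 2 - t)) (DifferentiableAt.sqrt (by fun_prop) ?_)
    rw [← hk p, ← hn.inner_sq hβ hN]
    exact (pow_pos (hn.same_side p) 2).ne'
  have hgnn : IsCriticalAt I (fun q => normalMetric I β n q (n q) (n q)) p := by
    have e : (fun q => normalMetric I β n q (n q) (n q))
        = fun q => (⟪n q, N q⟫ + k) ^ 2 * ⟪n q, N q⟫ * ⟪n q, N q⟫ :=
      funext fun q => by
        rw [hn.normalMetric_left hβ hN, real_inner_comm (n q) (N q), conormalFactor, hk]
    rw [e]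
    exact hcos.comp (h := fun t => (t + k) ^ 2 * t * t) (by fun_prop)
  have h0 : ∀ q, normalMetric I β n q (n q) (Z q) = 0 := fun q => by
    rw [hn.normalMetric_left hβ hN, hZt, mul_zero]
  have h0' : ∀ q, normalMetric I β n q (Z q) (n q) = 0 := fun q => by
    rw [hn.normalMetric_symm, h0]
  have h := hn.leviCivita_spec hβ hN hnd hnd hZ
  rw [koszul, hgnn.2, mlieBracket_swap_apply (V := n) (W := Z), mlieBracket_self] at h
  simp only [h0, h0', mvfderiv_const, Pi.zero_apply] at h
  have hneg : ∀ u : TangentSpace I p, normalMetric I β n p (-u) (n p)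
      = -normalMetric I β n p u (n p) := fun u => by
    rw [← neg_one_smul ℝ u, hn.normalMetric_smul]; ring
  have hzero : normalMetric I β n p (0 : TangentSpace I p) (Z p) = 0 := by
    rw [← zero_smul ℝ (0 : TangentSpace I p), hn.normalMetric_smul, zero_mul]
  rw [hneg, hzero, hn.normalMetric_symm p _ (n p), hn.normalMetric_left hβ hN] at h
  -- `kN - B` is the tangential part of `n`: it is orthogonal to `N` because `⟨B, N⟩ = k`.
  have hT : MDiffAt (T% (fun q => k • N q - dualField β N n q)) p :=
    mdifferentiableAt_sub_section (mdifferentiableAt_const.smul_section hNd) hBd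
  have hTt : ∀ q, ⟪N q, k • N q - dualField β N n q⟫ = (0 : ℝ) := fun q => by
    rw [inner_sub_right, inner_smul_right, hN.inner_self, real_inner_comm,
      hn.inner_dualField hβ hN, hk]
    ring
  have hdec : n = (fun q => (⟪n q, N q⟫ : ℝ)) • N + (fun q => k • N q - dualField β N n q) := by
    ext1 q
    simp only [dualField, conormalFactor, hk, Pi.add_apply, Pi.smul_apply', add_smul]
    abel
  -- Involutivity removes the tangential part of `n`, and criticality of `⟨n, N⟩` removes the
  -- Leibniz term.
  have hbr : (⟪N p, mlieBracket I Z n p⟫ : ℝ) = ⟪n p, N p⟫ * ⟪curvatureVector I N p, Z p⟫ := by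
    have hfrob := hN.inner_mlieBracket_eq_zero hZ hT hZt hTt
    rw [hN.inner_curvatureVector hZ hZt]
    conv_lhs => rw [hdec]
    rw [mlieBracket_add_right (hcos.1.smul_section hNd) hT, mlieBracket_smul_right hcos.1 hNd,
      hcos.2, inner_add_right, hfrob]
    simp [inner_smul_right]
  rw [hbr] at h
  simp at h
  linarith

end Differential

/-! ### From the Cartan torsion to the curvature vector. -/

section Main

variable {E : Type*} [NormedAddCommGroup E] [NormedSpace ℝ E]
  {H : Type*} [TopologicalSpace H] {I : ModelWithCorners ℝ E H}
  {M : Type*} [TopologicalSpace M] [ChartedSpace H M] [IsManifold I ∞ M]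
  [RiemannianBundle (fun p : M => TangentSpace I p)]

local notation "⟪" x ", " y "⟫" => inner ℝ x y

variable {𝓕 : CodimOneFoliation I M} {N : ∀ p : M, TangentSpace I p}
  {β : ∀ p : M, TangentSpace I p →L[ℝ] ℝ} {n : ∀ p : M, TangentSpace I p}

theorem IsFinslerNormal.norm_dualField (hn : IsFinslerNormal I 𝓕 N β n)
    (hβ : IsRandersForm I β) (hN : IsUnitNormal I 𝓕 N) (p : M) : ‖dualField β N n p‖ = ‖β p‖ := by
  rw [← innerSL_apply_norm ℝ (dualField β N n p)]
  congr 1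
  ext v
  exact hn.inner_dualField hβ hN p v

/-- The norm of `β` is `|β(N)|` if and only if `β` vanishes on the leaf. -/
theorem IsFinslerNormal.norm_sq_eq_iff (hn : IsFinslerNormal I 𝓕 N β n)
    (hβ : IsRandersForm I β) (hN : IsUnitNormal I 𝓕 N) (p : M) :
    ‖β p‖ ^ 2 = β p (N p) ^ 2 ↔ ∀ v ∈ 𝓕.tangent p, β p v = 0 := by
  set B := dualField β N n p with hB
  have hBN : ⟪B, N p⟫ = β p (N p) := hn.inner_dualField hβ hN p _
  -- Pythagoras: the left side is the squared length of the leafwise part of the dual of `β`.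
  have hdiff : ⟪B - β p (N p) • N p, B - β p (N p) • N p⟫ = ‖β p‖ ^ 2 - β p (N p) ^ 2 := by
    rw [← hn.norm_dualField hβ hN, ← real_inner_self_eq_norm_sq, ← hB]
    simp only [inner_sub_left, inner_sub_right, real_inner_smul_left, inner_smul_right,
      real_inner_comm B (N p), hBN, hN.inner_self]
    ring
  constructor
  · intro h v hv
    rw [h, sub_self] at hdiff
    have h0 : B = β p (N p) • N p := sub_eq_zero.1 (inner_self_eq_zero.1 hdiff)
    rw [← hn.inner_dualField hβ hN, ← hB, h0, real_inner_smul_left, hN.orthogonal p v hv, mul_zero]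
  · intro h
    have hmem : B - β p (N p) • N p ∈ 𝓕.tangent p := by
      rw [hN.mem_tangent_iff, inner_sub_right, inner_smul_right, hN.inner_self,
        real_inner_comm, hBN, mul_one, sub_self]
    have h0 := h _ hmem
    rw [inner_sub_left, hn.inner_dualField hβ hN, h0, real_inner_smul_left,
      hN.orthogonal p _ hmem, mul_zero, sub_zero] at hdiff
    linarith

variable [FiniteDimensional ℝ E]

/-- `C_n^♯` represents the Cartan torsion `C_n(·, ·, ∇_n n)`. -/
theorem IsFinslerNormal.normalMetric_cartanSharp (hn : IsFinslerNormal I 𝓕 N β n)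
    (hβ : IsRandersForm I β) (p : M) (u v : TangentSpace I p) :
    normalMetric I β n p (cartanSharp I β n p u) v
      = cartanTorsion (randersNorm I β p) (n p) u v (leviCivita I (normalMetric I β n) n n p) := by
  have : FiniteDimensional ℝ (TangentSpace I p) := inferInstanceAs (FiniteDimensional ℝ E)
  let G : LinearMap.BilinForm ℝ (TangentSpace I p) :=
    LinearMap.mk₂ ℝ (normalMetric I β n p) (hn.normalMetric_add p) (hn.normalMetric_smul p)
      (fun u v v' => by
        rw [hn.normalMetric_symm, hn.normalMetric_add, hn.normalMetric_symm,
          hn.normalMetric_symm p v'])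
      (fun a u v => by rw [hn.normalMetric_symm, hn.normalMetric_smul, hn.normalMetric_symm]; rfl)
  have hinj : Function.Injective G := by
    rw [← LinearMap.ker_eq_bot, LinearMap.ker_eq_bot']
    exact fun u hu => hn.normalMetric_nondegenerate hβ u fun v => congrArg (fun l => l v) hu
  have hsurj : Function.Surjective G :=
    (LinearMap.injective_iff_surjective_of_finrank_eq_finrank
      (Subspace.dual_finrank_eq (K := ℝ) (V := TangentSpace I p)).symm).1 hinj
  set w := leviCivita I (normalMetric I β n) n n p
  have hC := fun v => cartanTorsion_randers (β p) (hn.unit p) u v w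
  let φ : TangentSpace I p →ₗ[ℝ] ℝ :=
    { toFun := fun v => cartanTorsion (randersNorm I β p) (n p) u v w
      map_add' := fun v v' => by
        refine (hC _).trans ?_
        refine Eq.trans ?_ (congrArg₂ (· + ·) (hC v) (hC v')).symm
        simp only [inner_add_left, inner_add_right, map_add]
        ring
      map_smul' := fun a v => by
        refine (hC _).trans ?_
        refine Eq.trans ?_ (congrArg (a * ·) (hC v)).symm
        simp only [real_inner_smul_left, inner_smul_right, map_smul, smul_eq_mul]
        ring }
  obtain ⟨x, hx⟩ := hsurj φ
  exact Classical.epsilon_spec (p := fun x : TangentSpace I p => ∀ v, normalMetric I β n p x v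
    = cartanTorsion (randersNorm I β p) (n p) u v w) ⟨x, fun v => congrArg (fun l => l v) hx⟩ v

theorem IsFinslerNormal.cartanSharp_eq_zero (hn : IsFinslerNormal I 𝓕 N β n)
    (hβ : IsRandersForm I β) (hN : IsUnitNormal I 𝓕 N) {p : M}
    (h : ∀ v ∈ 𝓕.tangent p,
      normalMetric I β n p (leviCivita I (normalMetric I β n) n n p) v = 0)
    (u : TangentSpace I p) : cartanSharp I β n p u = 0 := by
  obtain ⟨a, ha⟩ := hn.eq_smul_of_normalMetric_eq_zero hβ hN h
  refine hn.normalMetric_nondegenerate hβ _ fun v => ?_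
  rw [hn.normalMetric_cartanSharp hβ, ha]
  exact cartanTorsion_randers_smul (β p) (hn.unit p) u v a

/-- If `C_n^♯` vanishes at `p`, then `∇_n n` is `g`-orthogonal to the leaf or `β` vanishes on
the leaf. -/
theorem IsFinslerNormal.of_cartanSharp_eq_zero (hn : IsFinslerNormal I 𝓕 N β n)
    (hβ : IsRandersForm I β) (hN : IsUnitNormal I 𝓕 N) {p : M}
    (h : ∀ u, cartanSharp I β n p u = 0) :
    (∀ v ∈ 𝓕.tangent p, normalMetric I β n p (leviCivita I (normalMetric I β n) n n p) v = 0)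
      ∨ ∀ v ∈ 𝓕.tangent p, β p v = 0 := by
  set w := leviCivita I (normalMetric I β n) n n p
  have hC : ∀ u v, cartanTorsion (fun x => ‖x‖ + β p x) (n p) u v w = 0 := fun u v => by
    have h1 := hn.normalMetric_cartanSharp hβ p u v
    rw [h u, ← zero_smul ℝ (0 : TangentSpace I p), hn.normalMetric_smul, zero_mul] at h1
    exact h1.symm
  refine (eq_smul_or_of_cartanTorsion_randers_eq_zero (β p) (hn.unit p) hC).imp ?_ ?_
  · intro hw v hv
    rw [hw, hn.normalMetric_smul, hn.normal p v hv, mul_zero]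
  · intro hb v hv
    have h1 := hn.inner_add_apply hβ hN p v
    rw [hN.orthogonal p v hv, mul_zero, hb v] at h1
    -- On the leaf `⟨n, v⟩ + β(v) = 0`, while here `β(v) = β(n)⟨n, v⟩`.
    have h2 : (1 + β p (n p)) * (⟪n p, v⟫ : ℝ) = 0 := by linarith
    rw [hb v, (mul_eq_zero.1 h2).resolve_left (hβ.one_add_apply_pos hn p).ne', mul_zero]

variable [IsContMDiffRiemannianBundle I ∞ E (fun p : M => TangentSpace I p)]

/-- The curvature vector is itself tangent to the leaf because `N` has unit length, so it can be
tested against itself. -/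
theorem IsUnitNormal.curvatureVector_eq_zero (hN : IsUnitNormal I 𝓕 N) {p : M}
    (h : ∀ v ∈ 𝓕.tangent p, ⟪curvatureVector I N p, v⟫ = (0 : ℝ)) : curvatureVector I N p = 0 := by
  refine inner_self_eq_zero.1 (h _ ?_)
  rw [hN.mem_tangent_iff, real_inner_comm, hN.inner_curvatureVector_self]

/-- A parallel form has a locally constant norm. -/
theorem IsFinslerNormal.isCriticalAt_of_isParallelForm (hn : IsFinslerNormal I 𝓕 N β n)
    (hβ : IsRandersForm I β) (hN : IsUnitNormal I 𝓕 N)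
    (h : IsParallelForm I (riemannianMetric I) β) (p : M) :
    IsCriticalAt I (fun q => (⟪dualField β N n q, dualField β N n q⟫ : ℝ)) p := by
  have hBd := hn.mdifferentiableAt_dualField hβ hN p
  refine ⟨Randers.mdifferentiableAt_inner hBd hBd, ?_⟩
  ext x
  have hX : MDiffAt (T% (FiberBundle.extend E x)) p := FiberBundle.mdifferentiableAt_extend ..
  have h1 := h (FiberBundle.extend E x) (dualField β N n) p hX hBd
  -- Koszul's formula gives `2⟨∇̄_X B, B⟩ = X|B|²`, whereas parallelism gives `X|B|² = ⟨∇̄_X B, B⟩`;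
  -- hence both vanish.
  have h2 := leviCivita_riemannianMetric_spec hX hBd hBd
  have e1 : (fun q => β q (dualField β N n q))
      = fun q => (⟪dualField β N n q, dualField β N n q⟫ : ℝ) :=
    funext fun q => (hn.inner_dualField hβ hN q _).symm
  have e2 : (fun q => (⟪FiberBundle.extend E x q, dualField β N n q⟫ : ℝ))
      = fun q => (⟪dualField β N n q, FiberBundle.extend E x q⟫ : ℝ) :=
    funext fun q => real_inner_comm _ _
  rw [covDerivForm, e1, ← hn.inner_dualField hβ hN, real_inner_comm] at h1
  simp only [koszul, riemannianMetric, e2] at h2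
  rw [mlieBracket_swap_apply (V := FiberBundle.extend E x), mlieBracket_self] at h2
  simp only [Pi.zero_apply, inner_neg_left, inner_zero_left] at h2
  simp only [FiberBundle.extend_apply_self] at h1 h2
  rw [zero_apply]
  linarith

end Main

end Randers

/-! ### The two statements on `C_n^♯`. -/

theorem mainTheorem10 (m : ℕ) {M : Type*} [TopologicalSpace M] [T2Space M] [SigmaCompactSpace M]
    [ChartedSpace (EuclideanSpace ℝ (Fin (m + 1))) M] [IsManifold (𝓡 (m + 1)) ∞ M]
    [RiemannianBundle (fun p : M => TangentSpace (𝓡 (m + 1)) p)]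
    [IsContMDiffRiemannianBundle (𝓡 (m + 1)) ∞ (EuclideanSpace ℝ (Fin (m + 1)))
      (fun p : M => TangentSpace (𝓡 (m + 1)) p)]
    (𝓕 : Randers.CodimOneFoliation (𝓡 (m + 1)) M)
    (N : ∀ p : M, TangentSpace (𝓡 (m + 1)) p) (hN : Randers.IsUnitNormal (𝓡 (m + 1)) 𝓕 N)
    (β : ∀ p : M, TangentSpace (𝓡 (m + 1)) p →L[ℝ] ℝ) (hβ : Randers.IsRandersForm (𝓡 (m + 1)) β)
    (n : ∀ p : M, TangentSpace (𝓡 (m + 1)) p)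
    (hn : Randers.IsFinslerNormal (𝓡 (m + 1)) 𝓕 N β n) :
    (Randers.IsParallelForm (𝓡 (m + 1)) (Randers.riemannianMetric (𝓡 (m + 1))) β →
      (∃ k : ℝ, ∀ p, β p (N p) = k) →
      (∀ p, Randers.curvatureVector (𝓡 (m + 1)) N p = 0) →
      ∀ p u, Randers.cartanSharp (𝓡 (m + 1)) β n p u = 0) ∧
    (3 < m →
      (∃ k : ℝ, 0 ≤ k ∧ ∀ p, β p (N p) = k) →
      (∃ r : ℝ, ∀ p, ‖β p‖ = r) →
      (∃ p, ∃ u ∈ 𝓕.tangent p, β p u ≠ 0) →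
      ((∀ p u, Randers.cartanSharp (𝓡 (m + 1)) β n p u = 0) ↔
        ∀ p, Randers.curvatureVector (𝓡 (m + 1)) N p = 0)) := by
  refine ⟨fun hpar ⟨k, hk⟩ hZ p u => ?_, fun _ ⟨k, _, hk⟩ ⟨r, hr⟩ ⟨p₀, u₀, hu₀, hβu₀⟩ => ?_⟩
  · refine hn.cartanSharp_eq_zero hβ hN (fun v hv => ?_) u
    rw [hn.normalMetric_leviCivita hβ hN hk (hn.isCriticalAt_of_isParallelForm hβ hN hpar p) hv,
      hZ p, inner_zero_left, mul_zero]
  have hcrit : ∀ p, Randers.IsCriticalAt (𝓡 (m + 1))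
      (fun q => (inner ℝ (Randers.dualField β N n q) (Randers.dualField β N n q) : ℝ)) p := by
    intro p
    have e : (fun q => (inner ℝ (Randers.dualField β N n q) (Randers.dualField β N n q) : ℝ))
        = fun _ => r ^ 2 :=
      funext fun q => by rw [real_inner_self_eq_norm_sq, hn.norm_dualField hβ hN, hr]
    rw [e]
    exact ⟨mdifferentiableAt_const, mvfderiv_const _⟩
  refine ⟨fun h p => hN.curvatureVector_eq_zero fun v hv => ?_, fun hZ p u => ?_⟩
  · rcases hn.of_cartanSharp_eq_zero hβ hN (h p) with h1 | h1
    · have h2 := h1 v hv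
      rw [hn.normalMetric_leviCivita hβ hN hk (hcrit p) hv] at h2
      exact (mul_eq_zero.1 h2).resolve_left (mul_pos (pow_pos (hn.conormalFactor_pos hβ hN p) 2)
        (pow_pos (hn.same_side p) 2)).ne'
    -- Vanishing of `β` on the leaf at `p` means `r² = k²`, which carries over to `p₀`, where `β(u₀)
    -- ≠ 0`.
    · rw [← hn.norm_sq_eq_iff hβ hN, hr, hk, ← hr p₀, ← hk p₀, hn.norm_sq_eq_iff hβ hN] at h1
      exact absurd (h1 u₀ hu₀) hβu₀
  · refine hn.cartanSharp_eq_zero hβ hN (fun v hv => ?_) u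
    rw [hn.normalMetric_leviCivita hβ hN hk (hcrit p) hv, hZ p, inner_zero_left, mul_zero]
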